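/- An ordered metric space is a metric space $X$ with a partial order whose graph is closed in $X\times X$. It is \emph{L-ordered} if for all $x,y\in X$ one has $x\le y$ if and only if $f(x)\le f(y)$ for every short (i.e. $1$-Lipschitz) monotone function $f:X\to\mathbb{R}$. For a metric space $X$, let $PX$ be the set of Radon probability measures $p$ on $X$ of finite first moment (every short $f:X\to\mathbb{R}$ is $p$-integrable), with the Kantorovich--Wasserstein distance $d(p,q)=\sup_f\left(\int f\,dq-\int f\,dp\right)$, where $f$ ranges over the short functions $X\to\mathbb{R}$; if $X$ is ordered, $PX$ carries the stochastic order: $p\le q$ if and only if there is a coupling of $p$ and $q$ supported on $\{(x,y): x\le y\}$. With the Dirac embedding $\delta:X\to PX$ and the averaging map $E:PPX\to PX$, $(E\mu)(S)=\int p(S)\,d\mu(p)$, this is the ordered Kantorovich monad on the category of L-ordered complete metric spaces and short monotone maps. A $P$-algebra is thus an L-ordered complete metric space $A$ with a short monotone map $e:PA\to A$ such that $e\circ\delta=\mathrm{id}_A$ and $e\circ Pe=e\circ E$, where $Pe$ is the pushforward of measures along $e$. An \emph{ordered Banach space} is a real Banach space $B$ with a closed convex cone $B^+\ni 0$ (not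 required to satisfy $B^+\cap(-B^+)=\{0\}$); for $x,y\in B$, put $x\le y$ if and only if $y-x\in B^+$. \textbf{Theorem.} Every $P$-algebra $(A,e)$ in the category of L-ordered complete metric spaces is isomorphic to a closed convex subset of an ordered Banach space: there are an ordered Banach space $(B,B^+)$, a closed convex subset $K\subseteq B$ and a bijective isometry $\varphi:A\to K$ such that $a\le b$ if and only if $\varphi(b)-\varphi(a)\in B^+$ for all $a,b\in A$, and such that for every $p\in PA$ the map $\varphi:A\to B$ is $p$-integrable and $\varphi(e(p))=\int_A\varphi(a)\,dp(a)$ (that is, $\varphi$ carries $e$ to the algebra structure of $K$ given by integration). -/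

import Mathlib

open MeasureTheory Filter Topology
open scoped ENNReal NNReal

universe u

/-- A metric space with a partial order is *L-ordered* if the order is determined by the
short (`1`-Lipschitz) monotone real functions. -/
class LOrdered (X : Type*) [MetricSpace X] [PartialOrder X] : Prop where
  le_iff : ∀ x y : X,
    x ≤ y ↔ ∀ f : X → ℝ, LipschitzWith 1 f → Monotone f → f x ≤ f y

/-- `PX`: the Radon probability measures of finite first moment on a metric space `X`
(with its Borel `σ`-algebra). -/
@[ext]
structure RadonP (X : Type*) [MetricSpace X] [MeasurableSpace X] [BorelSpace X] where
  /-- the underlying Borel measure -/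
  toMeasure : Measure X
  isProb : IsProbabilityMeasure toMeasure
  radon : toMeasure.InnerRegular
  moment : ∀ f : X → ℝ, LipschitzWith 1 f → Integrable f toMeasure

namespace RadonP

section Basic

variable {X : Type*} [MetricSpace X] [MeasurableSpace X] [BorelSpace X]

instance (p : RadonP X) : IsProbabilityMeasure p.toMeasure := p.isProb
instance (p : RadonP X) : p.toMeasure.InnerRegular := p.radon

theorem exists_bound (p q : RadonP X) : ∃ M : ℝ, ∀ f : X → ℝ, LipschitzWith 1 f →
    (∫ x, f x ∂q.toMeasure) - ∫ x, f x ∂p.toMeasure ≤ M := by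
  obtain ⟨x₀⟩ : Nonempty X := nonempty_of_isProbabilityMeasure p.toMeasure
  have hd : LipschitzWith 1 (fun x : X => dist x x₀) := LipschitzWith.dist_left x₀
  refine ⟨(∫ x, dist x x₀ ∂q.toMeasure) + ∫ x, dist x x₀ ∂p.toMeasure, fun f hf => ?_⟩
  have hb : ∀ x, |f x - f x₀| ≤ dist x x₀ := fun x => by
    simpa [Real.dist_eq] using hf.dist_le_mul x x₀
  have h1 : (∫ x, f x ∂q.toMeasure) ≤ ∫ x, (dist x x₀ + f x₀) ∂q.toMeasure :=
    integral_mono (q.moment f hf) ((q.moment _ hd).add (integrable_const _))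
      (fun x => by have := abs_le.1 (hb x); simp only; linarith)
  have h2 : (∫ x, (f x₀ - dist x x₀) ∂p.toMeasure) ≤ ∫ x, f x ∂p.toMeasure :=
    integral_mono ((integrable_const _).sub (p.moment _ hd)) (p.moment f hf)
      (fun x => by have := abs_le.1 (hb x); simp only; linarith)
  rw [integral_add (q.moment _ hd) (integrable_const _)] at h1
  rw [integral_sub (integrable_const _) (p.moment _ hd)] at h2
  simp only [integral_const, probReal_univ, smul_eq_mul, one_mul] at h1 h2
  linarith

/-- The Kantorovich-Wasserstein distance: the supremum of `∫ f dq - ∫ f dp` over all short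
functions `f`. -/
noncomputable def kdist (p q : RadonP X) : ℝ :=
  ⨆ f : {f : X → ℝ // LipschitzWith 1 f},
    ((∫ x, f.1 x ∂q.toMeasure) - ∫ x, f.1 x ∂p.toMeasure)

theorem kdist_bdd (p q : RadonP X) : BddAbove (Set.range
    fun f : {f : X → ℝ // LipschitzWith 1 f} =>
      ((∫ x, f.1 x ∂q.toMeasure) - ∫ x, f.1 x ∂p.toMeasure)) := by
  obtain ⟨M, hM⟩ := exists_bound p q
  exact ⟨M, by rintro _ ⟨f, rfl⟩; exact hM f.1 f.2⟩

theorem sub_le_kdist (p q : RadonP X) {f : X → ℝ} (hf : LipschitzWith 1 f) :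
    (∫ x, f x ∂q.toMeasure) - (∫ x, f x ∂p.toMeasure) ≤ kdist p q :=
  le_ciSup (kdist_bdd p q) ⟨f, hf⟩

instance : Nonempty {f : X → ℝ // LipschitzWith 1 f} :=
  ⟨⟨fun _ => 0, (LipschitzWith.const (0 : ℝ)).weaken zero_le_one⟩⟩

theorem kdist_le (p q : RadonP X) {M : ℝ} (h : ∀ f : X → ℝ, LipschitzWith 1 f →
    (∫ x, f x ∂q.toMeasure) - (∫ x, f x ∂p.toMeasure) ≤ M) : kdist p q ≤ M :=
  ciSup_le fun f => h f.1 f.2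

theorem kdist_comm_le (p q : RadonP X) : kdist p q ≤ kdist q p := by
  refine kdist_le p q fun f hf => ?_
  have := sub_le_kdist q p (f := fun x => - f x) hf.neg
  simp only [integral_neg] at this
  linarith

theorem integral_lipschitz (p : RadonP X) {K : ℝ≥0} {f : X → ℝ} (hf : LipschitzWith K f) :
    Integrable f p.toMeasure := by
  have h : LipschitzWith 1 (fun x => ((K : ℝ) + 1)⁻¹ * f x) := by
    refine LipschitzWith.of_dist_le_mul fun x y => ?_
    have hx := hf.dist_le_mul x y
    rw [Real.dist_eq] at hx ⊢
    have hK : (0 : ℝ) < (K : ℝ) + 1 := by positivity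
    rw [← mul_sub, abs_mul, abs_of_pos (inv_pos.2 hK), inv_mul_le_iff₀ hK]
    have : (0 : ℝ) ≤ dist x y := dist_nonneg
    simp only [NNReal.coe_one, one_mul]
    nlinarith
  have h2 := (p.moment _ h).const_mul ((K : ℝ) + 1)
  refine h2.congr (ae_of_all _ fun x => ?_)
  have hK : ((K : ℝ) + 1) ≠ 0 := by positivity
  simp only
  field_simp

theorem abs_integral_sub_le (p q : RadonP X) {K : ℝ≥0} {f : X → ℝ} (hf : LipschitzWith K f) :
    |(∫ x, f x ∂p.toMeasure) - ∫ x, f x ∂q.toMeasure| ≤ ((K : ℝ) + 1) * kdist p q := by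
  have h : LipschitzWith 1 (fun x => ((K : ℝ) + 1)⁻¹ * f x) := by
    refine LipschitzWith.of_dist_le_mul fun x y => ?_
    have hx := hf.dist_le_mul x y
    rw [Real.dist_eq] at hx ⊢
    have hK : (0 : ℝ) < (K : ℝ) + 1 := by positivity
    rw [← mul_sub, abs_mul, abs_of_pos (inv_pos.2 hK), inv_mul_le_iff₀ hK]
    have : (0 : ℝ) ≤ dist x y := dist_nonneg
    simp only [NNReal.coe_one, one_mul]
    nlinarith
  have hK : (0 : ℝ) < (K : ℝ) + 1 := by positivity
  have h1 := sub_le_kdist p q h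
  have h2 := (sub_le_kdist q p h).trans (kdist_comm_le q p)
  rw [integral_const_mul, integral_const_mul, ← mul_sub, inv_mul_le_iff₀ hK] at h1 h2
  exact abs_le.2 ⟨by linarith, by linarith⟩

theorem eq_of_integral_eq (p q : RadonP X)
    (h : ∀ f : X → ℝ, LipschitzWith 1 f →
      (∫ x, f x ∂q.toMeasure) = ∫ x, f x ∂p.toMeasure) : p = q := by
  have hk : kdist p q ≤ 0 := kdist_le p q fun f hf => by rw [h f hf, sub_self]
  have hk' : 0 ≤ kdist p q := by
    have := sub_le_kdist p q ((LipschitzWith.const (0 : ℝ)).weaken zero_le_one)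
    simpa using this
  have hk0 : kdist p q = 0 := le_antisymm hk hk'
  ext1
  refine ext_of_generate_finite {F : Set X | IsClosed F}
    (by rw [BorelSpace.measurable_eq (α := X), borel_eq_generateFrom_isClosed])
    isPiSystem_isClosed (fun F hF => ?_) (by simp)
  have hpos : ∀ n : ℕ, (0 : ℝ) < 1 / ((n : ℝ) + 1) := fun n => Nat.one_div_pos_of_nat
  have t1 := tendsto_lintegral_thickenedIndicator_of_isClosed p.toMeasure hF hpos
    tendsto_one_div_add_atTop_nhds_zero_nat
  have t2 := tendsto_lintegral_thickenedIndicator_of_isClosed q.toMeasure hF hpos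
    tendsto_one_div_add_atTop_nhds_zero_nat
  refine tendsto_nhds_unique t1 (t2.congr fun n => ?_)
  have hL := lipschitzWith_thickenedIndicator (hpos n) F
  have hL' : LipschitzWith _ (fun x => ((thickenedIndicator (hpos n) F x : ℝ≥0) : ℝ)) := hL
  have e := abs_integral_sub_le p q hL'
  rw [hk0, mul_zero, abs_nonpos_iff, sub_eq_zero] at e
  have conv : ∀ r : RadonP X, (∫⁻ x, (thickenedIndicator (hpos n) F x : ℝ≥0∞) ∂r.toMeasure)
      = ENNReal.ofReal (∫ x, ((thickenedIndicator (hpos n) F x : ℝ≥0) : ℝ) ∂r.toMeasure) := by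
    intro r
    rw [ofReal_integral_eq_lintegral_ofReal (r.integral_lipschitz hL')
      (ae_of_all _ fun x => NNReal.coe_nonneg _)]
    simp
  rw [conv, conv, e]

noncomputable instance : MetricSpace (RadonP X) where
  dist := kdist
  dist_self p := le_antisymm (kdist_le p p fun f _ => by rw [sub_self])
    (by simpa using sub_le_kdist p p ((LipschitzWith.const (0 : ℝ)).weaken zero_le_one))
  dist_comm p q := le_antisymm (kdist_comm_le p q) (kdist_comm_le q p)
  dist_triangle p q r := kdist_le p r fun f hf => by
    have := sub_le_kdist p q hf
    have := sub_le_kdist q r hf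
    linarith
  eq_of_dist_eq_zero {p q} h := eq_of_integral_eq p q fun f hf => by
    have h1 := sub_le_kdist p q hf
    have h2 := (sub_le_kdist q p hf).trans (kdist_comm_le q p)
    change kdist p q = 0 at h
    linarith

theorem dist_def (p q : RadonP X) : dist p q = kdist p q := rfl

noncomputable instance : MeasurableSpace (RadonP X) := borel _
instance : BorelSpace (RadonP X) := ⟨rfl⟩

/-- A coupling of `p` and `q`: a Borel measure on `X × X` with marginals `p` and `q`. -/
def IsCoupling (r : @Measure (X × X) (borel (X × X))) (p q : RadonP X) : Prop :=
  @Measure.map (X × X) X (borel (X × X)) _ Prod.fst r = p.toMeasure ∧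
  @Measure.map (X × X) X (borel (X × X)) _ Prod.snd r = q.toMeasure

/-- The stochastic order on `PX`: `p ≤ q` if some coupling of `p` and `q` is concentrated on
the (closed) graph of the order of `X`. -/
instance [PartialOrder X] : LE (RadonP X) where
  le p q := ∃ r : @Measure (X × X) (borel (X × X)),
    IsCoupling r p q ∧ r {z | ¬ z.1 ≤ z.2} = 0

/-- The unit `δ : X → PX`. -/
noncomputable def dirac (x : X) : RadonP X where
  toMeasure := Measure.dirac x
  isProb := inferInstance
  radon := by
    refine ⟨fun U hU r hr => ?_⟩
    by_cases hx : x ∈ U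
    · refine ⟨{x}, Set.singleton_subset_iff.2 hx, isCompact_singleton, ?_⟩
      rw [Measure.dirac_apply_of_mem hx] at hr
      rwa [Measure.dirac_apply_of_mem (Set.mem_singleton x)]
    · rw [Measure.dirac_apply' _ hU, Set.indicator_of_notMem hx] at hr
      exact absurd hr not_lt_zero
  moment f hf := by
    refine integrable_dirac' hf.continuous.measurable.stronglyMeasurable ?_
    simp

end Basic

section Map

variable {X : Type*} [MetricSpace X] [MeasurableSpace X] [BorelSpace X]
variable {Y : Type*} [MetricSpace Y] [MeasurableSpace Y] [BorelSpace Y]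

/-- The functor on morphisms: the pushforward `f_* p` along a short map `f`. -/
noncomputable def map (f : X → Y) (hf : LipschitzWith 1 f) (p : RadonP X) : RadonP Y where
  toMeasure := p.toMeasure.map f
  isProb := Measure.isProbabilityMeasure_map hf.continuous.measurable.aemeasurable
  radon := Measure.InnerRegular.map_of_continuous hf.continuous
  moment g hg := by
    rw [integrable_map_measure hg.continuous.measurable.aestronglyMeasurable
      hf.continuous.measurable.aemeasurable]
    exact p.moment _ (by simpa using hg.comp hf)

end Map

section Mult

variable {X : Type*} [MetricSpace X] [MeasurableSpace X] [BorelSpace X]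

theorem continuous_integral {K : ℝ≥0} {f : X → ℝ} (hf : LipschitzWith K f) :
    Continuous fun p : RadonP X => ∫ x, f x ∂p.toMeasure := by
  refine LipschitzWith.continuous (K := K + 1) (LipschitzWith.of_dist_le_mul fun p q => ?_)
  simpa [Real.dist_eq, dist_def] using abs_integral_sub_le p q hf

theorem measurable_toMeasure : Measurable (toMeasure : RadonP X → Measure X) := by
  refine Measurable.measure_of_isPiSystem_of_isProbabilityMeasure (S := {F : Set X | IsClosed F})
    (by rw [BorelSpace.measurable_eq (α := X), borel_eq_generateFrom_isClosed])
    isPiSystem_isClosed fun F hF => ?_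
  have hpos : ∀ n : ℕ, (0 : ℝ) < 1 / ((n : ℝ) + 1) := fun n => Nat.one_div_pos_of_nat
  refine measurable_of_tendsto_metrizable
    (f := fun (n : ℕ) (p : RadonP X) =>
      ∫⁻ x, (thickenedIndicator (hpos n) F x : ℝ≥0∞) ∂p.toMeasure) (fun n => ?_)
    (tendsto_pi_nhds.2 fun p => tendsto_lintegral_thickenedIndicator_of_isClosed p.toMeasure hF
      hpos tendsto_one_div_add_atTop_nhds_zero_nat)
  have hL := lipschitzWith_thickenedIndicator (hpos n) F
  have hL' : LipschitzWith _ (fun x => ((thickenedIndicator (hpos n) F x : ℝ≥0) : ℝ)) := hL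
  have conv : ∀ r : RadonP X, (∫⁻ x, (thickenedIndicator (hpos n) F x : ℝ≥0∞) ∂r.toMeasure)
      = ENNReal.ofReal (∫ x, ((thickenedIndicator (hpos n) F x : ℝ≥0) : ℝ) ∂r.toMeasure) := by
    intro r
    rw [ofReal_integral_eq_lintegral_ofReal (r.integral_lipschitz hL')
      (ae_of_all _ fun x => NNReal.coe_nonneg _)]
    simp
  simp only [conv]
  exact (ENNReal.continuous_ofReal.comp (continuous_integral hL')).measurable

/-- An inner regular finite measure is concentrated on a closed separable set. -/
theorem exists_separable {Y : Type*} [MetricSpace Y] [MeasurableSpace Y] [BorelSpace Y]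
    (μ : Measure Y) [IsFiniteMeasure μ] [μ.InnerRegular] :
    ∃ S : Set Y, IsClosed S ∧ TopologicalSpace.IsSeparable S ∧ μ Sᶜ = 0 := by
  have h : ∀ n : ℕ, ∃ K : Set Y, IsCompact K ∧ μ Kᶜ ≤ ((n : ℝ≥0∞) + 1)⁻¹ := by
    intro n
    obtain ⟨K, -, hK, hle⟩ := MeasurableSet.univ.exists_isCompact_sdiff_lt (μ := μ)
      (measure_ne_top μ _) (ε := ((n : ℝ≥0∞) + 1)⁻¹) (by simp)
    exact ⟨K, hK, by simpa [Set.compl_eq_univ_sdiff] using hle.le⟩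
  choose K hK hKle using h
  refine ⟨closure (⋃ n, K n), isClosed_closure,
    (TopologicalSpace.IsSeparable.iUnion fun n => (hK n).isSeparable).closure, ?_⟩
  have hle : ∀ n : ℕ, μ (closure (⋃ n, K n))ᶜ ≤ ((n : ℝ≥0∞) + 1)⁻¹ := fun n =>
    (measure_mono (Set.compl_subset_compl.2
      ((Set.subset_iUnion K n).trans subset_closure))).trans (hKle n)
  have ht : Tendsto (fun n : ℕ => ((n : ℝ≥0∞) + 1)⁻¹) atTop (𝓝 0) := by
    have := (tendsto_add_atTop_iff_nat 1).2 ENNReal.tendsto_inv_nat_nhds_zero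
    simpa using this
  exact le_antisymm (ge_of_tendsto' ht hle) zero_le

/-- A finite measure concentrated on a closed separable set of a complete metric space is
inner regular. -/
theorem innerRegular_of_separable [CompleteSpace X] (μ : Measure X) [IsFiniteMeasure μ]
    {S : Set X} (hS : IsClosed S) (hsep : TopologicalSpace.IsSeparable S) (h0 : μ Sᶜ = 0) :
    μ.InnerRegular := by
  have : TopologicalSpace.SeparableSpace S := hsep.separableSpace
  have : SecondCountableTopology S := UniformSpace.secondCountable_of_separable S
  have : CompleteSpace S := hS.completeSpace_coe
  have h1 : (μ.comap ((↑) : S → X)).InnerRegular := inferInstance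
  have h2 : ((μ.comap ((↑) : S → X)).map ((↑) : S → X)).InnerRegular :=
    Measure.InnerRegular.map_of_continuous continuous_subtype_val
  rw [map_comap_subtype_coe hS.measurableSet, Measure.restrict_eq_self_of_ae_mem] at h2
  · exact h2
  · exact h0

theorem exists_separable_join (μ : RadonP (RadonP X)) : ∃ S : Set X, IsClosed S ∧
    TopologicalSpace.IsSeparable S ∧ (μ.toMeasure.bind toMeasure) Sᶜ = 0 := by
  obtain ⟨D, -, hDs, hD0⟩ := exists_separable μ.toMeasure
  obtain ⟨c, hc, hDc⟩ := hDs
  choose T hTc hTs hT0 using fun p : RadonP X => exists_separable p.toMeasure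
  have hSs : TopologicalSpace.IsSeparable (closure (⋃ p ∈ c, T p)) :=
    by
    have := hc.to_subtype
    rw [Set.biUnion_eq_iUnion]
    exact (TopologicalSpace.IsSeparable.iUnion fun p : c => hTs p).closure
  refine ⟨closure (⋃ p ∈ c, T p), isClosed_closure, hSs, ?_⟩
  set S := closure (⋃ p ∈ c, T p) with hSdef
  have hm : Measurable fun p : RadonP X => p.toMeasure Sᶜ :=
    (Measure.measurable_coe isClosed_closure.measurableSet.compl).comp measurable_toMeasure
  rw [Measure.bind_apply isClosed_closure.measurableSet.compl measurable_toMeasure.aemeasurable,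
    lintegral_eq_zero_iff hm]
  have hsub : closure c ⊆ {p : RadonP X | p.toMeasure Sᶜ = 0} := by
    intro p hp
    have hinf : LipschitzWith 1 (fun x => Metric.infDist x S) := Metric.lipschitz_infDist_pt S
    have hz : ∀ q : RadonP X, (∫ x, Metric.infDist x S ∂q.toMeasure = 0) →
        S.Nonempty → q.toMeasure Sᶜ = 0 := by
      intro q hq hne
      rw [integral_eq_zero_iff_of_nonneg (fun x => Metric.infDist_nonneg) (q.moment _ hinf)] at hq
      refine measure_mono_null (fun x hx => ?_) hq
      intro h
      exact hx ((isClosed_closure.mem_iff_infDist_zero hne).2 h)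
    have hcz : ∀ q ∈ c, q.toMeasure Sᶜ = 0 := fun q hq =>
      measure_mono_null (Set.compl_subset_compl.2
        ((Set.subset_biUnion_of_mem hq).trans subset_closure)) (hT0 q)
    have hne : S.Nonempty := by
      obtain ⟨q, hq⟩ : c.Nonempty := closure_nonempty_iff.1 ⟨p, hp⟩
      by_contra hS
      have := hcz q hq
      rw [Set.not_nonempty_iff_eq_empty.1 hS, Set.compl_empty, measure_univ] at this
      exact one_ne_zero this
    refine hz p ?_ hne
    have hcl : IsClosed {q : RadonP X | ∫ x, Metric.infDist x S ∂q.toMeasure = 0} :=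
      isClosed_eq (continuous_integral hinf) continuous_const
    refine closure_minimal (fun q hq => ?_) hcl hp
    change ∫ x, Metric.infDist x S ∂q.toMeasure = 0
    refine integral_eq_zero_of_ae ?_
    have : ∀ᵐ x ∂q.toMeasure, x ∈ S := hcz q hq
    filter_upwards [this] with x hx
    exact Metric.infDist_zero_of_mem hx
  have : ∀ᵐ p ∂μ.toMeasure, p ∈ D := hD0
  filter_upwards [this] with p hp
  exact hsub (hDc hp)

/-- The multiplication `E : PPX → PX`, `(Eμ)(S) = ∫ p(S) dμ(p)`. -/
noncomputable def expect [CompleteSpace X] (μ : RadonP (RadonP X)) : RadonP X where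
  toMeasure := μ.toMeasure.bind toMeasure
  isProb := ⟨by
    rw [Measure.bind_apply MeasurableSet.univ measurable_toMeasure.aemeasurable]
    simp⟩
  radon := by
    have : IsProbabilityMeasure (μ.toMeasure.bind toMeasure) := ⟨by
      rw [Measure.bind_apply MeasurableSet.univ measurable_toMeasure.aemeasurable]
      simp⟩
    obtain ⟨S, h1, h2, h3⟩ := exists_separable_join μ
    exact innerRegular_of_separable _ h1 h2 h3
  moment f hf := by
    refine ⟨hf.continuous.measurable.aestronglyMeasurable, ?_⟩
    have habs : LipschitzWith 1 (fun x => |f x|) := by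
      refine LipschitzWith.of_dist_le_mul fun x y => ?_
      have := hf.dist_le_mul x y
      rw [Real.dist_eq] at this ⊢
      exact (abs_abs_sub_abs_le (f x) (f y)).trans this
    have hF : LipschitzWith 1 (fun p : RadonP X => ∫ x, |f x| ∂p.toMeasure) := by
      refine LipschitzWith.of_dist_le_mul fun p q => ?_
      have h1 := sub_le_kdist p q habs
      have h2 := (sub_le_kdist q p habs).trans (kdist_comm_le q p)
      rw [Real.dist_eq, dist_def, NNReal.coe_one, one_mul]
      exact abs_le.2 ⟨by linarith, by linarith⟩
    have hfin := (μ.moment _ hF).2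
    rw [HasFiniteIntegral] at hfin ⊢
    rw [Measure.lintegral_bind measurable_toMeasure.aemeasurable
      hf.continuous.measurable.enorm.aemeasurable]
    refine lt_of_eq_of_lt (lintegral_congr fun p => ?_) hfin
    rw [Real.enorm_of_nonneg (integral_nonneg fun x => abs_nonneg _),
      ofReal_integral_eq_lintegral_ofReal (p.moment _ habs) (ae_of_all _ fun x => abs_nonneg _)]
    exact lintegral_congr fun x => by rw [← Real.enorm_eq_ofReal_abs]

end Mult

end RadonP

/-- An algebra of the ordered Kantorovich monad `(P, δ, E)` with underlying ordered complete
metric space `A`: a short monotone structure map `e : PA → A` satisfying the unit law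
`e ∘ δ = id` and the associativity law `e ∘ Pe = e ∘ E`. -/
structure OrderedKantorovichAlgebra (A : Type*) [MetricSpace A] [CompleteSpace A]
    [PartialOrder A] [MeasurableSpace A] [BorelSpace A] where
  /-- the structure map -/
  e : RadonP A → A
  short : LipschitzWith 1 e
  mono : ∀ p q : RadonP A, p ≤ q → e p ≤ e q
  unit : ∀ a : A, e (RadonP.dirac a) = a
  assoc : ∀ μ : RadonP (RadonP A), e (RadonP.map e short μ) = e (RadonP.expect μ)

/-!
An algebra `A` is embedded by evaluating the short affine functions on it, where `f` is affine if
`f (e p) = ∫ f dp` for all `p`. The target is the Banach space of bounded functions on the set of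
short affine functions vanishing at a base point, and the cone consists of the vectors that are
nonnegative at the monotone ones. Integration holds coordinatewise by construction, so everything
rests on there being enough short affine functions to recover the distance and the order.

Both cases follow from one separation theorem (`OrderedKantorovichAlgebra.exists_isAffine`), for a
cost `c ≤ dist` on `A` satisfying the triangle inequality and
`c (s x + t z, s y + t z) ≤ s c (x, y)`. For the distance, `c = dist`. For the order,
`c = monoCost`, the supremum of `g x - g y` over the short monotone `g`; by L-orderedness it is
positive unless `x ≤ y`, and it is contracted by convex combinations because
`s⁻¹ g (s · + t z)` is again short and monotone.

To separate, embed `PA` isometrically as a convex set in a Banach space and put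
`Q p k = c (e p, e k)`. The functional `N (r (p - k)) = r Q p k` is well defined by the catalytic
argument of `IsMixingCost.le_mul_of_sub_eq`, and it is sublinear and bounded by the norm. The
Hahn-Banach theorem gives a continuous functional `F` with increments bounded by `Q` that attains
`Q` at the given pair. As `Q` vanishes between `p` and the Dirac measure at `e p`, and `F` commutes
with Bochner integrals, `x ↦ F (δ x)` is affine.
-/

/-! ### Asymmetric costs on convex sets and their supporting functionals -/

/-- A sublinear functional on a real vector space is attained at any given vector by a linear
functional lying below it. -/
theorem exists_linearMap_le_sublinear_eq {V : Type*} [AddCommGroup V] [Module ℝ V] (N : V → ℝ)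
    (N_hom : ∀ c : ℝ, 0 < c → ∀ x, N (c • x) = c * N x)
    (N_add : ∀ x y, N (x + y) ≤ N x + N y) (v : V) :
    ∃ g : V →ₗ[ℝ] ℝ, g v = N v ∧ ∀ x, g x ≤ N x := by
  have N0 : N 0 = 0 := by
    have := N_hom 2 two_pos 0
    rw [smul_zero] at this
    linarith
  have H : ∀ c : ℝ, c • v = 0 → (RingHom.id ℝ) c • N v = 0 := by
    intro c hc
    rcases smul_eq_zero.1 hc with h | h
    · simp [h]
    · simp [h, N0]
  obtain ⟨g, hg, hgN⟩ := exists_extension_of_le_sublinear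
    (LinearPMap.mkSpanSingleton' v (N v) H) N N_hom N_add (by
      rintro ⟨x, hx⟩
      obtain ⟨c, rfl⟩ := Submodule.mem_span_singleton.1 hx
      rw [LinearPMap.mkSpanSingleton'_apply]
      simp only [RingHom.id_apply, smul_eq_mul]
      rcases lt_trichotomy c 0 with hc | rfl | hc
      · have h1 := N_add (c • v) ((-c) • v)
        rw [← add_smul, add_neg_cancel, zero_smul, N0, N_hom (-c) (neg_pos.2 hc)] at h1
        linarith
      · simp [N0]
      · exact (N_hom c hc v).ge)
  refine ⟨g, ?_, hgN⟩
  exact (hg ⟨v, Submodule.mem_span_singleton_self v⟩).trans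
    (LinearPMap.mkSpanSingleton'_apply_self v (N v) H _)

/-- A possibly asymmetric transport cost `Q` on a family `ι : P → E` whose range is a convex set:
`Q` satisfies the triangle inequality, is dominated by the norm distance, and mixing both endpoints
with a common third point, in proportion `t : 1 - t`, contracts `Q` by the factor `t`. -/
structure IsMixingCost {P E : Type*} [NormedAddCommGroup E] [NormedSpace ℝ E]
    (ι : P → E) (Q : P → P → ℝ) : Prop where
  exists_mix : ∀ p k : P, ∀ t : ℝ, 0 ≤ t → t ≤ 1 → ∃ m, ι m = t • ι p + (1 - t) • ι k
  nonneg : ∀ p p', 0 ≤ Q p p'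
  triangle : ∀ p k p', Q p p' ≤ Q p k + Q k p'
  le_mul : ∀ p p' k m m' : P, ∀ t : ℝ, 0 ≤ t → t ≤ 1 → ι m = t • ι p + (1 - t) • ι k →
    ι m' = t • ι p' + (1 - t) • ι k → Q m m' ≤ t * Q p p'
  le_norm : ∀ p p', Q p p' ≤ ‖ι p - ι p'‖

namespace IsMixingCost

variable {P E : Type*} [NormedAddCommGroup E] [NormedSpace ℝ E] {ι : P → E} {Q : P → P → ℝ}

theorem eq_zero (h : IsMixingCost ι Q) {p p' : P} (hp : ι p = ι p') : Q p p' = 0 := by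
  refine le_antisymm ?_ (h.nonneg p p')
  have := h.le_norm p p'
  rwa [hp, sub_self, norm_zero] at this

/-- If `a - b = r (p - p')`, then moving from `a` to `b` costs at most `r` times moving from `p`
to `p'`. A small proportion of `p` is mixed in and serves as a catalyst: replacing it by `p'`
moves the rest of the mixture a small step from `a` towards `b` and restores it. -/
theorem le_mul_of_sub_eq (h : IsMixingCost ι Q) {a b p p' : P} {r : ℝ} (hr : 0 < r)
    (hab : ι a - ι b = r • (ι p - ι p')) : Q a b ≤ r * Q p p' := by
  have key : ∀ n : ℕ, (n : ℝ) * (Q a b - r * Q p p') ≤ r * (Q a p + Q p b) := by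
    intro n
    rcases Nat.eq_zero_or_pos n with rfl | hn
    · have := h.nonneg a p
      have := h.nonneg p b
      simp only [Nat.cast_zero, zero_mul]
      positivity
    have hn' : (0 : ℝ) < n := Nat.cast_pos.2 hn
    have hnr : (0 : ℝ) < n + r := by positivity
    -- with the proportion `r / (n + r)` of the catalyst, `n` steps lead exactly from `a` to `b`
    set ε : ℝ := r / (n + r) with hε
    have hε0 : 0 ≤ ε := by positivity
    have hε1 : ε ≤ 1 := by
      rw [hε, div_le_one hnr]
      linarith
    have hmix : ∀ i : ℕ, ∃ k, i ≤ n →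
        ι k = ((i : ℝ) / n) • ι b + (1 - (i : ℝ) / n) • ι a := by
      intro i
      by_cases hi : i ≤ n
      · obtain ⟨k, hk⟩ := h.exists_mix b a ((i : ℝ) / n) (by positivity)
          ((div_le_one hn').2 (Nat.cast_le.2 hi))
        exact ⟨k, fun _ => hk⟩
      · exact ⟨a, fun h => absurd h hi⟩
    choose k hk using hmix
    have hm : ∀ i : ℕ, ∃ m, ι m = ε • ι p + (1 - ε) • ι (k i) := fun i =>
      h.exists_mix p (k i) ε hε0 hε1
    choose m hm using hm
    have hstep : ∀ i < n, Q (m i) (m (i + 1)) ≤ ε * Q p p' := by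
      intro i hi
      refine h.le_mul p p' (k i) _ _ ε hε0 hε1 (hm i) ?_
      rw [hm, hk i hi.le, hk (i + 1) hi]
      have e : ε • (ι p - ι p') = ((1 - ε) / n) • (ι a - ι b) := by
        rw [hab, smul_smul]
        congr 1
        rw [hε]
        field_simp
        ring
      have e2 : ι p = ι p' + (ι p - ι p') := by abel
      rw [e2, smul_add, e]
      push_cast
      module
    have hsum : ∀ i ≤ n, Q (m 0) (m i) ≤ i * (ε * Q p p') := by
      intro i
      induction i with
      | zero => intro _; simp [h.eq_zero]
      | succ i ih =>
        intro hi
        have h1 := ih (by omega)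
        have h2 := hstep i (by omega)
        have h3 := h.triangle (m 0) (m i) (m (i + 1))
        push_cast
        linarith
    have h0 : Q a (m 0) ≤ ε * Q a p := by
      refine h.le_mul a p a _ _ ε hε0 hε1 (by module) ?_
      rw [hm, hk 0 (Nat.zero_le n)]
      simp
    have h1 : Q (m n) b ≤ ε * Q p b := by
      refine h.le_mul p b b _ _ ε hε0 hε1 ?_ (by module)
      rw [hm, hk n le_rfl, div_self hn'.ne']
      simp
    have h2 := hsum n le_rfl
    have h3 := h.triangle a (m 0) b
    have h4 := h.triangle (m 0) (m n) b
    have h5 : Q a b ≤ ε * (Q a p + n * Q p p' + Q p b) := by linarith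
    rw [hε, div_mul_eq_mul_div, le_div_iff₀ hnr] at h5
    have h6 := mul_nonneg hr.le (h.nonneg a b)
    linarith
  by_contra! hlt
  obtain ⟨n, hn⟩ := exists_nat_gt (r * (Q a p + Q p b) / (Q a b - r * Q p p'))
  rw [div_lt_iff₀ (sub_pos.2 hlt)] at hn
  exact absurd (key n) (not_le.2 hn)

theorem mul_le_mul_of_smul_sub_eq (h : IsMixingCost ι Q) {p p' k k' : P} {r s : ℝ} (hr : 0 ≤ r)
    (hs : 0 ≤ s) (he : r • (ι p - ι p') = s • (ι k - ι k')) : r * Q p p' ≤ s * Q k k' := by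
  rcases hr.eq_or_lt with rfl | hr
  · rw [zero_mul]
    exact mul_nonneg hs (h.nonneg _ _)
  rcases hs.eq_or_lt with rfl | hs
  · rw [zero_smul, smul_eq_zero_iff_right hr.ne', sub_eq_zero] at he
    simp [h.eq_zero he]
  have := h.le_mul_of_sub_eq (a := p) (b := p') (p := k) (p' := k') (div_pos hs hr) (by
    rw [div_eq_inv_mul, ← smul_smul, ← he, smul_smul, inv_mul_cancel₀ hr.ne', one_smul])
  calc r * Q p p' ≤ r * (s / r * Q k k') := by gcongr
    _ = s * Q k k' := by field_simp

theorem mul_eq_mul_of_smul_sub_eq (h : IsMixingCost ι Q) {p p' k k' : P} {r s : ℝ} (hr : 0 ≤ r)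
    (hs : 0 ≤ s) (he : r • (ι p - ι p') = s • (ι k - ι k')) : r * Q p p' = s * Q k k' :=
  le_antisymm (h.mul_le_mul_of_smul_sub_eq hr hs he) (h.mul_le_mul_of_smul_sub_eq hs hr he.symm)

/-- Sums of scaled differences of points of a convex set are again scaled differences, and the
cost of the sum is at most the sum of the costs. -/
theorem exists_add (h : IsMixingCost ι Q) (p p' k k' : P) {r s : ℝ} (hr : 0 ≤ r) (hs : 0 ≤ s) :
    ∃ m m', r • (ι p - ι p') + s • (ι k - ι k') = (r + s) • (ι m - ι m') ∧
      (r + s) * Q m m' ≤ r * Q p p' + s * Q k k' := by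
  rcases (add_nonneg hr hs).eq_or_lt with h0 | h0
  · obtain rfl : r = 0 := by linarith
    obtain rfl : s = 0 := by linarith
    exact ⟨p, p, by simp, by simp⟩
  set t : ℝ := r / (r + s) with ht
  have ht' : 1 - t = s / (r + s) := by rw [ht]; field_simp; ring
  have ht0 : 0 ≤ t := by positivity
  have ht0' : 0 ≤ 1 - t := by rw [ht']; positivity
  obtain ⟨m, hm⟩ := h.exists_mix p k t ht0 (by linarith)
  obtain ⟨l, hl⟩ := h.exists_mix p' k t ht0 (by linarith)
  obtain ⟨m', hm'⟩ := h.exists_mix p' k' t ht0 (by linarith)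
  have h1 := h.le_mul p p' k m l t ht0 (by linarith) hm hl
  have h2 := h.le_mul k k' p' l m' (1 - t) ht0' (by linarith) (by rw [hl]; module)
    (by rw [hm']; module)
  have h3 := h.triangle m l m'
  have e1 : (r + s) * t = r := by rw [ht]; field_simp
  have e2 : (r + s) * (1 - t) = s := by rw [ht']; field_simp
  refine ⟨m, m', ?_, ?_⟩
  · rw [hm, hm']
    calc r • (ι p - ι p') + s • (ι k - ι k')
        = ((r + s) * t) • (ι p - ι p') + ((r + s) * (1 - t)) • (ι k - ι k') := by rw [e1, e2]
      _ = _ := by module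
  · calc (r + s) * Q m m' ≤ (r + s) * (t * Q p p' + (1 - t) * Q k k') := by gcongr; linarith
      _ = ((r + s) * t) * Q p p' + ((r + s) * (1 - t)) * Q k k' := by ring
      _ = _ := by rw [e1, e2]

/-- The vectors `r (p - p')` with `r ≥ 0` and `p`, `p'` points of the convex set. -/
def directions (h : IsMixingCost ι Q) (p₀ : P) : Submodule ℝ E where
  carrier := {w | ∃ (r : ℝ) (p p' : P), 0 ≤ r ∧ w = r • (ι p - ι p')}
  zero_mem' := ⟨0, p₀, p₀, le_rfl, by simp⟩
  add_mem' := by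
    rintro _ _ ⟨r, p, p', hr, rfl⟩ ⟨s, k, k', hs, rfl⟩
    obtain ⟨m, m', e, -⟩ := h.exists_add p p' k k' hr hs
    exact ⟨r + s, m, m', add_nonneg hr hs, e⟩
  smul_mem' := by
    rintro c _ ⟨r, p, p', hr, rfl⟩
    rcases le_total 0 c with hc | hc
    · exact ⟨c * r, p, p', mul_nonneg hc hr, by rw [smul_smul]⟩
    · exact ⟨-c * r, p', p, mul_nonneg (neg_nonneg.2 hc) hr, by module⟩

/-- A mixing cost is, at any given pair of points, attained by a continuous linear functional whose
increments are everywhere bounded by the cost. -/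
theorem exists_functional (h : IsMixingCost ι Q) (a b : P) :
    ∃ F : E →L[ℝ] ℝ, F (ι a) - F (ι b) = Q a b ∧ ∀ p p', F (ι p) - F (ι p') ≤ Q p p' := by
  have hW : ∀ w : h.directions a, ∃ (r : ℝ) (p p' : P), 0 ≤ r ∧ (w : E) = r • (ι p - ι p') :=
    fun w => w.2
  choose r p p' hr hw using hW
  -- the cost, transported to differences; it does not depend on the chosen representation
  let N : h.directions a → ℝ := fun w => r w * Q (p w) (p' w)
  have hN : ∀ (w : h.directions a) {s : ℝ} {k k' : P}, 0 ≤ s → (w : E) = s • (ι k - ι k') →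
      N w = s * Q k k' := fun w s k k' hs e =>
    h.mul_eq_mul_of_smul_sub_eq (hr w) hs ((hw w).symm.trans e)
  have hdiff : ∀ k k' : P, ι k - ι k' ∈ h.directions a := fun k k' =>
    ⟨1, k, k', zero_le_one, by simp⟩
  have hNle : ∀ w, N w ≤ ‖w‖ := by
    intro w
    change N w ≤ ‖(w : E)‖
    rw [hw w, norm_smul, Real.norm_of_nonneg (hr w)]
    exact mul_le_mul_of_nonneg_left (h.le_norm _ _) (hr w)
  obtain ⟨g, hg, hgN⟩ := exists_linearMap_le_sublinear_eq N
    (fun c hc w => by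
      rw [hN (c • w) (s := c * r w) (k := p w) (k' := p' w) (mul_nonneg hc.le (hr w)) (by
        rw [Submodule.coe_smul, hw w, smul_smul]), mul_assoc])
    (fun v w => by
      obtain ⟨m, m', e, hle⟩ := h.exists_add (p v) (p' v) (p w) (p' w) (hr v) (hr w)
      rw [hN (v + w) (add_nonneg (hr v) (hr w)) (by rw [Submodule.coe_add, hw v, hw w, e])]
      exact hle)
    ⟨ι a - ι b, hdiff a b⟩
  have hgn : ∀ w, ‖g w‖ ≤ 1 * ‖w‖ := by
    intro w
    rw [one_mul, Real.norm_eq_abs, abs_le]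
    have h1 := (hgN w).trans (hNle w)
    have h2 := (hgN (-w)).trans (hNle (-w))
    rw [map_neg, norm_neg] at h2
    exact ⟨by linarith, h1⟩
  obtain ⟨F, hF, -⟩ := _root_.exists_extension_norm_eq (h.directions a) (g.mkContinuous 1 hgn)
  have hFs : ∀ k k', F (ι k) - F (ι k') = g ⟨ι k - ι k', hdiff k k'⟩ := fun k k' => by
    rw [← map_sub]
    exact hF ⟨ι k - ι k', hdiff k k'⟩
  have hNs : ∀ k k', N ⟨ι k - ι k', hdiff k k'⟩ = Q k k' := fun k k' => by
    rw [hN _ (s := 1) (k := k) (k' := k') zero_le_one (by simp), one_mul]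
  refine ⟨F, ?_, fun k k' => ?_⟩
  · rw [hFs, hg, hNs]
  · rw [hFs, ← hNs]
    exact hgN _

end IsMixingCost

/-! ### Barycentres of Radon probability measures in Banach spaces -/

namespace RadonP

section Integral

variable {X : Type*} [MetricSpace X] [MeasurableSpace X] [BorelSpace X]

/-- A short map into a Banach space is Bochner integrable: a Radon measure is concentrated on a
separable set, so separability of the target is not needed. -/
theorem integrable_of_lipschitzWith {G : Type*} [NormedAddCommGroup G] (p : RadonP X) {g : X → G}
    (hg : LipschitzWith 1 g) : Integrable g p.toMeasure := by
  borelize G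
  obtain ⟨S, -, hS, h0⟩ := exists_separable p.toMeasure
  have hm : AEStronglyMeasurable g p.toMeasure :=
    aestronglyMeasurable_iff_aemeasurable_separable.2
      ⟨hg.continuous.measurable.aemeasurable, g '' S, hS.image hg.continuous, by
        have : ∀ᵐ x ∂p.toMeasure, x ∈ S := h0
        filter_upwards [this] with x hx using Set.mem_image_of_mem g hx⟩
  obtain ⟨x₀⟩ : Nonempty X := nonempty_of_isProbabilityMeasure p.toMeasure
  refine ((p.moment _ (LipschitzWith.dist_left x₀)).add (integrable_const ‖g x₀‖)).mono' hm
    (ae_of_all _ fun x => ?_)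
  have h1 := hg.dist_le_mul x x₀
  rw [dist_eq_norm, NNReal.coe_one, one_mul] at h1
  have h2 : ‖g x‖ ≤ ‖g x - g x₀‖ + ‖g x₀‖ := by
    simpa using norm_add_le (g x - g x₀) (g x₀)
  exact h2.trans (by simpa using h1)

end Integral

section Eval

variable {X : Type*} [MetricSpace X] {I : Set (X → ℝ)} {x₀ : X}

/-- Evaluation of a family `I` of short functions vanishing at a base point, as a map into the
Banach space of bounded real functions on `I`. -/
noncomputable def evalMap (hI : ∀ f ∈ I, LipschitzWith 1 f ∧ f x₀ = 0) (x : X) :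
    lp (fun _ : I => ℝ) ∞ :=
  ⟨fun f => f.1 x, memℓp_infty ⟨dist x x₀, by
    rintro _ ⟨f, rfl⟩
    have h := (hI f.1 f.2).1.dist_le_mul x x₀
    rw [(hI f.1 f.2).2, NNReal.coe_one, one_mul, dist_zero_right] at h
    exact h⟩⟩

variable (hI : ∀ f ∈ I, LipschitzWith 1 f ∧ f x₀ = 0)

@[simp]
theorem evalMap_apply (x : X) (f : I) : evalMap hI x f = f.1 x := rfl

theorem evalMap_base : evalMap hI x₀ = 0 := by
  ext f
  exact (hI f.1 f.2).2

theorem lipschitzWith_evalMap : LipschitzWith 1 (evalMap hI) := by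
  refine LipschitzWith.of_dist_le_mul fun x y => ?_
  rw [dist_eq_norm]
  refine lp.norm_le_of_forall_le (by positivity) fun f => ?_
  simpa [Real.dist_eq] using (hI f.1 f.2).1.dist_le_mul x y

variable [MeasurableSpace X] [BorelSpace X]

theorem integral_evalMap_apply (p : RadonP X) (f : I) :
    (∫ x, evalMap hI x ∂p.toMeasure) f = ∫ x, f.1 x ∂p.toMeasure :=
  ((lp.evalCLM ℝ (fun _ : I => ℝ) ∞ f).integral_comp_comm
    (p.integrable_of_lipschitzWith (lipschitzWith_evalMap hI))).symm

end Eval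

/-! ### Mixtures -/

section Mix

variable {X : Type*} [MetricSpace X] [MeasurableSpace X] [BorelSpace X]

/-- The mixture `s p + t k` of two measures with weights `s + t = 1`. -/
noncomputable def mix (s t : ℝ≥0) (hst : s + t = 1) (p k : RadonP X) : RadonP X where
  toMeasure := s • p.toMeasure + t • k.toMeasure
  isProb := ⟨by
    rw [Measure.add_apply, Measure.smul_apply, Measure.smul_apply, measure_univ, measure_univ,
      ENNReal.smul_def, ENNReal.smul_def, smul_eq_mul, smul_eq_mul, mul_one, mul_one,
      ← ENNReal.coe_add, hst, ENNReal.coe_one]⟩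
  radon := inferInstance
  moment f hf := ((p.moment f hf).smul_measure_nnreal).add_measure
    ((k.moment f hf).smul_measure_nnreal)

variable {s t : ℝ≥0} (hst : s + t = 1)

theorem integral_mix {G : Type*} [NormedAddCommGroup G] [NormedSpace ℝ G] (p k : RadonP X)
    {g : X → G} (hg : LipschitzWith 1 g) :
    ∫ x, g x ∂(mix s t hst p k).toMeasure
      = (s : ℝ) • ∫ x, g x ∂p.toMeasure + (t : ℝ) • ∫ x, g x ∂k.toMeasure := by
  have h1 := (p.integrable_of_lipschitzWith hg).smul_measure_nnreal (c := s)
  have h2 := (k.integrable_of_lipschitzWith hg).smul_measure_nnreal (c := t)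
  change ∫ x, g x ∂(s • p.toMeasure + t • k.toMeasure) = _
  rw [integral_add_measure h1 h2, integral_smul_nnreal_measure, integral_smul_nnreal_measure]
  rfl

theorem integral_dirac_eq {G : Type*} [NormedAddCommGroup G] [NormedSpace ℝ G] [CompleteSpace G]
    (x : X) (g : X → G) : ∫ y, g y ∂(dirac x).toMeasure = g x :=
  integral_dirac g x

theorem dist_mix_dirac_le (x y : X) (k : RadonP X) :
    dist (mix s t hst (dirac x) k) (mix s t hst (dirac y) k) ≤ s * dist x y := by
  refine kdist_le _ _ fun f hf => ?_
  rw [integral_mix hst _ _ hf, integral_mix hst _ _ hf, integral_dirac_eq, integral_dirac_eq]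
  have h := hf.dist_le_mul y x
  rw [NNReal.coe_one, one_mul, Real.dist_eq, dist_comm] at h
  have := mul_le_mul_of_nonneg_left ((le_abs_self _).trans h) (NNReal.coe_nonneg s)
  simp only [smul_eq_mul]
  linarith

theorem mix_dirac_le_mix_dirac [PartialOrder X] [OrderClosedTopology X] {x y : X} (hxy : x ≤ y)
    (z : X) : mix s t hst (dirac x) (dirac z) ≤ mix s t hst (dirac y) (dirac z) := by
  let _ : MeasurableSpace (X × X) := borel (X × X)
  have : BorelSpace (X × X) := ⟨rfl⟩
  have h1 : Measurable (Prod.fst : X × X → X) := continuous_fst.measurable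
  have h2 : Measurable (Prod.snd : X × X → X) := continuous_snd.measurable
  have hle : MeasurableSet {z : X × X | ¬ z.1 ≤ z.2} :=
    OrderClosedTopology.isClosed_le'.measurableSet.compl
  refine ⟨s • Measure.dirac (x, y) + t • Measure.dirac (z, z), ⟨?_, ?_⟩, ?_⟩
  · rw [Measure.map_add _ _ h1, Measure.map_smul, Measure.map_smul,
      Measure.map_dirac' h1, Measure.map_dirac' h1]
    rfl
  · rw [Measure.map_add _ _ h2, Measure.map_smul, Measure.map_smul,
      Measure.map_dirac' h2, Measure.map_dirac' h2]
    rfl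
  · simp [Measure.dirac_apply' _ hle, hxy]

theorem map_mix_dirac {Y : Type*} [MetricSpace Y] [MeasurableSpace Y] [BorelSpace Y] (g : X → Y)
    (hg : LipschitzWith 1 g) (x y : X) :
    map g hg (mix s t hst (dirac x) (dirac y)) = mix s t hst (dirac (g x)) (dirac (g y)) := by
  have hm := hg.continuous.measurable
  ext1
  change (s • Measure.dirac x + t • Measure.dirac y).map g = _
  rw [Measure.map_add _ _ hm, Measure.map_smul, Measure.map_smul,
    Measure.map_dirac' hm, Measure.map_dirac' hm]
  rfl

theorem expect_mix_dirac [CompleteSpace X] (p k : RadonP X) :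
    expect (mix s t hst (dirac p) (dirac k)) = mix s t hst p k := by
  ext S hS
  change (s • Measure.dirac p + t • Measure.dirac k).bind toMeasure S
    = (s • p.toMeasure + t • k.toMeasure) S
  have hm : Measurable fun q : RadonP X => q.toMeasure S :=
    (Measure.measurable_coe hS).comp measurable_toMeasure
  rw [Measure.bind_apply hS measurable_toMeasure.aemeasurable, lintegral_add_measure,
    lintegral_smul_measure, lintegral_smul_measure, lintegral_dirac' _ hm, lintegral_dirac' _ hm]
  rfl

end Mix

end RadonP

/-! ### The monotone cost of an L-ordered space -/

theorem sub_le_dist_of_lipschitzWith {X : Type*} [MetricSpace X] {f : X → ℝ}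
    (hf : LipschitzWith 1 f) (x y : X) :
    f x - f y ≤ dist x y := by
  have h := hf.dist_le_mul x y
  rw [NNReal.coe_one, one_mul, Real.dist_eq] at h
  exact (le_abs_self _).trans h

section MonoCost

variable {X : Type*} [MetricSpace X] [PartialOrder X]

/-- The largest decrease `f x - f y` of a short monotone function from `x` to `y`. It is an
asymmetric distance, which vanishes when `x ≤ y`. -/
noncomputable def monoCost (x y : X) : ℝ :=
  ⨆ f : {f : X → ℝ // LipschitzWith 1 f ∧ Monotone f}, (f.1 x - f.1 y)

theorem sub_le_monoCost {f : X → ℝ} (hf : LipschitzWith 1 f) (hm : Monotone f) (x y : X) :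
    f x - f y ≤ monoCost x y :=
  le_ciSup (f := fun f : {f : X → ℝ // LipschitzWith 1 f ∧ Monotone f} => f.1 x - f.1 y)
    ⟨dist x y, by rintro _ ⟨f, rfl⟩; exact sub_le_dist_of_lipschitzWith f.2.1 x y⟩ ⟨f, hf, hm⟩

theorem monoCost_le {x y : X} {M : ℝ}
    (h : ∀ f : X → ℝ, LipschitzWith 1 f → Monotone f → f x - f y ≤ M) : monoCost x y ≤ M :=
  have : Nonempty {f : X → ℝ // LipschitzWith 1 f ∧ Monotone f} :=
    ⟨⟨fun _ => 0, (LipschitzWith.const (0 : ℝ)).weaken zero_le_one, monotone_const⟩⟩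
  ciSup_le fun f => h f.1 f.2.1 f.2.2

theorem monoCost_nonneg (x y : X) : 0 ≤ monoCost x y := by
  simpa using sub_le_monoCost ((LipschitzWith.const (0 : ℝ)).weaken zero_le_one)
    monotone_const x y

theorem monoCost_le_dist (x y : X) : monoCost x y ≤ dist x y :=
  monoCost_le fun _ hf _ => sub_le_dist_of_lipschitzWith hf x y

theorem monoCost_triangle (x z y : X) : monoCost x y ≤ monoCost x z + monoCost z y :=
  monoCost_le fun f hf hm => by
    have h1 := sub_le_monoCost hf hm x z
    have h2 := sub_le_monoCost hf hm z y
    linarith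

theorem monoCost_eq_zero_of_le {x y : X} (h : x ≤ y) : monoCost x y = 0 :=
  le_antisymm (monoCost_le fun _ _ hm => sub_nonpos.2 (hm h)) (monoCost_nonneg x y)

theorem monoCost_pos_of_not_le [LOrdered X] {x y : X} (h : ¬ x ≤ y) : 0 < monoCost x y := by
  rw [LOrdered.le_iff] at h
  push Not at h
  obtain ⟨f, hf, hm, hlt⟩ := h
  exact (sub_pos.2 hlt).trans_le (sub_le_monoCost hf hm x y)

end MonoCost

/-! ### Affine functions on algebras -/

namespace OrderedKantorovichAlgebra

open RadonP

variable {A : Type*} [MetricSpace A] [CompleteSpace A] [PartialOrder A] [MeasurableSpace A]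
  [BorelSpace A] (alg : OrderedKantorovichAlgebra A)

/-- Binary convex combinations in an algebra. -/
noncomputable def comb (s t : ℝ≥0) (hst : s + t = 1) (x y : A) : A :=
  alg.e (mix s t hst (dirac x) (dirac y))

/-- A function on an algebra is affine if it carries the structure map to integration. -/
def IsAffine (f : A → ℝ) : Prop :=
  ∀ p : RadonP A, f (alg.e p) = ∫ x, f x ∂p.toMeasure

variable {s t : ℝ≥0} (hst : s + t = 1)

theorem e_mix (p k : RadonP A) :
    alg.e (mix s t hst p k) = alg.comb s t hst (alg.e p) (alg.e k) := by
  rw [comb, ← map_mix_dirac hst alg.e alg.short, alg.assoc, expect_mix_dirac]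

theorem dist_comb_le (x y z : A) :
    dist (alg.comb s t hst x z) (alg.comb s t hst y z) ≤ s * dist x y := by
  have h := alg.short.dist_le_mul (mix s t hst (dirac x) (dirac z))
    (mix s t hst (dirac y) (dirac z))
  rw [NNReal.coe_one, one_mul] at h
  exact h.trans (dist_mix_dirac_le hst x y _)

/-- For a short monotone `f`, the function `x ↦ s⁻¹ f (s x + t z)` is again short and monotone. -/
theorem monoCost_comb_le [OrderClosedTopology A] (x y z : A) :
    monoCost (alg.comb s t hst x z) (alg.comb s t hst y z) ≤ s * monoCost x y := by
  rcases eq_or_ne s 0 with rfl | hs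
  · have h := alg.dist_comb_le hst x y z
    rw [NNReal.coe_zero, zero_mul] at h ⊢
    exact (monoCost_le_dist _ _).trans h
  have hs' : (0 : ℝ) < s := NNReal.coe_pos.2 (pos_iff_ne_zero.2 hs)
  refine monoCost_le fun f hf hm => ?_
  have hf' : LipschitzWith 1 fun u => (s : ℝ)⁻¹ * f (alg.comb s t hst u z) := by
    refine LipschitzWith.of_dist_le_mul fun u v => ?_
    have h1 := hf.dist_le_mul (alg.comb s t hst u z) (alg.comb s t hst v z)
    rw [NNReal.coe_one, one_mul] at h1 ⊢
    rw [Real.dist_eq, ← mul_sub, abs_mul, abs_of_pos (inv_pos.2 hs'), inv_mul_le_iff₀ hs',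
      ← Real.dist_eq]
    exact h1.trans (alg.dist_comb_le hst u v z)
  have hm' : Monotone fun u => (s : ℝ)⁻¹ * f (alg.comb s t hst u z) := fun u v huv =>
    mul_le_mul_of_nonneg_left (hm (alg.mono _ _ (mix_dirac_le_mix_dirac hst huv z)))
      (inv_nonneg.2 hs'.le)
  have h := sub_le_monoCost hf' hm' x y
  rwa [← mul_sub, inv_mul_le_iff₀ hs'] at h

variable {alg}

/-- Any distance-like cost on an algebra that is contracted by convex combinations is attained, at
a given pair of points, by an affine function whose increments are bounded by the cost. The
functional found on the Banach space spanned by `PA` commutes with Bochner integrals, so its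
restriction to the Dirac measures is affine. -/
theorem exists_isAffine {c : A → A → ℝ} (nonneg : ∀ x y, 0 ≤ c x y)
    (triangle : ∀ x z y, c x y ≤ c x z + c z y) (le_dist : ∀ x y, c x y ≤ dist x y)
    (comb_le : ∀ (s t : ℝ≥0) (hst : s + t = 1) (x y z : A),
      c (alg.comb s t hst x z) (alg.comb s t hst y z) ≤ s * c x y) (x₀ a b : A) :
    ∃ f : A → ℝ, f x₀ = 0 ∧ alg.IsAffine f ∧ f a - f b = c a b ∧ ∀ x y, f x - f y ≤ c x y := by
  have c_self : ∀ x, c x x = 0 := fun x => le_antisymm ((le_dist x x).trans_eq (dist_self x))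
    (nonneg x x)
  have hI : ∀ f ∈ {f : A → ℝ | LipschitzWith 1 f ∧ f x₀ = 0}, LipschitzWith 1 f ∧ f x₀ = 0 :=
    fun f hf => hf
  have hev := lipschitzWith_evalMap hI
  let ι : RadonP A → lp (fun _ : {f : A → ℝ | LipschitzWith 1 f ∧ f x₀ = 0} => ℝ) ∞ :=
    fun p => ∫ x, evalMap hI x ∂p.toMeasure
  have hιmix : ∀ (s t : ℝ≥0) (hst : s + t = 1) (p k : RadonP A),
      ι (mix s t hst p k) = (s : ℝ) • ι p + (t : ℝ) • ι k := fun s t hst p k =>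
    integral_mix hst p k hev
  have hιdirac : ∀ x, ι (dirac x) = evalMap hI x := fun x => integral_dirac_eq x _
  have hιdist : ∀ p k : RadonP A, dist p k ≤ ‖ι p - ι k‖ := by
    intro p k
    refine kdist_le p k fun f hf => ?_
    have hf₀ : LipschitzWith 1 fun x => f x - f x₀ := by
      simpa using hf.sub (LipschitzWith.const (f x₀))
    have h := lp.norm_apply_le_norm (by simp) (ι p - ι k) ⟨fun x => f x - f x₀, hf₀, by simp⟩
    rw [lp.coeFn_sub, Pi.sub_apply, integral_evalMap_apply, integral_evalMap_apply,
      integral_sub (p.moment f hf) (integrable_const _),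
      integral_sub (k.moment f hf) (integrable_const _)] at h
    simp only [integral_const, probReal_univ, one_smul, sub_sub_sub_cancel_right] at h
    rw [norm_sub_rev, Real.norm_eq_abs] at h
    exact (le_abs_self _).trans h
  have hιinj : Function.Injective ι := fun p k h =>
    dist_le_zero.1 ((hιdist p k).trans_eq (by rw [h, sub_self, norm_zero]))
  have hcoe : ∀ r : ℝ, ∀ h0 : 0 ≤ r, ∀ h1 : r ≤ 1, ∃ s t : ℝ≥0, s + t = 1 ∧ (s : ℝ) = r ∧
      (t : ℝ) = 1 - r := fun r h0 h1 => ⟨⟨r, h0⟩, ⟨1 - r, sub_nonneg.2 h1⟩,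
    NNReal.coe_injective (add_sub_cancel r 1), rfl, rfl⟩
  have hcost : IsMixingCost ι fun p k => c (alg.e p) (alg.e k) :=
    { exists_mix := by
        intro p k r h0 h1
        obtain ⟨s, t, hst, rfl, ht⟩ := hcoe r h0 h1
        exact ⟨mix s t hst p k, by rw [hιmix, ht]⟩
      nonneg := fun _ _ => nonneg _ _
      triangle := fun _ _ _ => triangle _ _ _
      le_mul := by
        intro p p' k m m' r h0 h1 hm hm'
        obtain ⟨s, t, hst, rfl, ht⟩ := hcoe r h0 h1
        rw [← ht, ← hιmix s t hst] at hm hm'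
        rw [hιinj hm, hιinj hm', e_mix, e_mix]
        exact comb_le s t hst _ _ _
      le_norm := fun p k => by
        have h := alg.short.dist_le_mul p k
        rw [NNReal.coe_one, one_mul] at h
        exact (le_dist _ _).trans (h.trans (hιdist p k)) }
  obtain ⟨F, hFab, hF⟩ := hcost.exists_functional (dirac a) (dirac b)
  simp only [hιdirac, alg.unit] at hFab
  refine ⟨fun x => F (evalMap hI x), by simp [evalMap_base], fun p => ?_, hFab, fun x y => ?_⟩
  · -- `p` and the Dirac measure at `e p` have the same image under `e`, hence cost zero
    have h1 := hF (dirac (alg.e p)) p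
    have h2 := hF p (dirac (alg.e p))
    simp only [alg.unit, c_self, hιdirac] at h1 h2
    rw [F.integral_comp_comm (p.integrable_of_lipschitzWith hev)]
    change F _ = F (ι p)
    linarith
  · simpa only [hιdirac, alg.unit] using hF (dirac x) (dirac y)

variable (alg)

/-- Short affine functions determine the distance of an algebra. -/
theorem exists_isAffine_sub_eq_dist (x₀ a b : A) :
    ∃ f : A → ℝ, LipschitzWith 1 f ∧ f x₀ = 0 ∧ alg.IsAffine f ∧ f a - f b = dist a b := by
  obtain ⟨f, h0, hf, hab, hle⟩ := exists_isAffine (alg := alg) (c := dist)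
    (fun _ _ => dist_nonneg) dist_triangle (fun _ _ => le_rfl)
    (fun _ _ hst => alg.dist_comb_le hst) x₀ a b
  exact ⟨f, LipschitzWith.of_le_add fun x y => by linarith [hle x y], h0, hf, hab⟩

/-- Short monotone affine functions determine the order of an L-ordered algebra. -/
theorem exists_isAffine_monotone_lt [OrderClosedTopology A] [LOrdered A] (x₀ : A) {a b : A}
    (hab : ¬ a ≤ b) : ∃ f : A → ℝ,
      LipschitzWith 1 f ∧ f x₀ = 0 ∧ alg.IsAffine f ∧ Monotone f ∧ f b < f a := by
  obtain ⟨f, h0, hf, he, hle⟩ := exists_isAffine (alg := alg) (c := monoCost)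
    monoCost_nonneg monoCost_triangle monoCost_le_dist
    (fun _ _ hst => alg.monoCost_comb_le hst) x₀ a b
  refine ⟨f, LipschitzWith.of_le_add fun x y => ?_, h0, hf, fun x y hxy => ?_, ?_⟩
  · linarith [hle x y, monoCost_le_dist x y]
  · linarith [hle x y, monoCost_eq_zero_of_le hxy]
  · linarith [monoCost_pos_of_not_le hab]

end OrderedKantorovichAlgebra

/-! ### The embedding -/

/-- The cone of those bounded functions on `I` that are nonnegative on a subset `J`. -/
noncomputable def nonnegOnCone {I : Type*} (J : Set I) : ProperCone ℝ (lp (fun _ : I => ℝ) ∞) where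
  carrier := {v | ∀ f ∈ J, 0 ≤ v f}
  zero_mem' := fun _ _ => le_rfl
  add_mem' := fun hv hw f hf => add_nonneg (hv f hf) (hw f hf)
  smul_mem' := fun c _ hv f hf => mul_nonneg c.2 (hv f hf)
  isClosed' := by
    have : {v : lp (fun _ : I => ℝ) ∞ | ∀ f ∈ J, 0 ≤ v f}
        = ⋂ f ∈ J, {v | 0 ≤ lp.evalCLM ℝ (fun _ : I => ℝ) ∞ f v} := by
      ext v
      simp only [Set.mem_ofPred_eq, Set.mem_iInter]
      rfl
    change IsClosed {v : lp (fun _ : I => ℝ) ∞ | ∀ f ∈ J, 0 ≤ v f}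
    rw [this]
    exact isClosed_biInter fun f _ => isClosed_le continuous_const
      (lp.evalCLM ℝ (fun _ : I => ℝ) ∞ f).continuous

theorem theorem5 {A : Type u} [MetricSpace A] [CompleteSpace A] [PartialOrder A]
    [OrderClosedTopology A] [LOrdered A] [MeasurableSpace A] [BorelSpace A]
    (alg : OrderedKantorovichAlgebra A) :
    ∃ (B : Type u) (_ : NormedAddCommGroup B) (_ : NormedSpace ℝ B) (_ : CompleteSpace B)
      (C : ProperCone ℝ B) (K : Set B),
      IsClosed K ∧ Convex ℝ K ∧
      ∃ φ : A ≃ᵢ K,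
        (∀ a b : A, a ≤ b ↔ (φ b : B) - (φ a : B) ∈ C) ∧
        ∀ p : RadonP A,
          Integrable (fun a => (φ a : B)) p.toMeasure ∧
          (φ (alg.e p) : B) = ∫ a, (φ a : B) ∂p.toMeasure := by
  rcases isEmpty_or_nonempty A with hA | ⟨⟨x₀⟩⟩
  · refine ⟨PUnit, inferInstance, inferInstance, inferInstance, ⊤, ∅, isClosed_empty, convex_empty,
      ⟨Equiv.equivOfIsEmpty _ _, fun a => hA.elim a⟩, fun a => hA.elim a,
      fun p => hA.elim (alg.e p)⟩
  let I : Set (A → ℝ) := {f | LipschitzWith 1 f ∧ f x₀ = 0 ∧ alg.IsAffine f}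
  have hI : ∀ f ∈ I, LipschitzWith 1 f ∧ f x₀ = 0 := fun f hf => ⟨hf.1, hf.2.1⟩
  have hlip := RadonP.lipschitzWith_evalMap hI
  have hiso : Isometry (RadonP.evalMap hI) := by
    refine Isometry.of_dist_eq fun a b => le_antisymm ?_ ?_
    · simpa using hlip.dist_le_mul a b
    · obtain ⟨f, hf, h0, haff, hab⟩ := alg.exists_isAffine_sub_eq_dist x₀ a b
      have h := lp.norm_apply_le_norm (by simp) (RadonP.evalMap hI a - RadonP.evalMap hI b)
        ⟨f, hf, h0, haff⟩
      rw [lp.coeFn_sub, Pi.sub_apply, RadonP.evalMap_apply, RadonP.evalMap_apply, hab,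
        Real.norm_eq_abs, abs_of_nonneg dist_nonneg] at h
      rwa [dist_eq_norm (RadonP.evalMap hI a)]
  have hint : ∀ p : RadonP A,
      RadonP.evalMap hI (alg.e p) = ∫ x, RadonP.evalMap hI x ∂p.toMeasure := by
    intro p
    ext f
    rw [RadonP.integral_evalMap_apply]
    exact f.2.2.2 p
  refine ⟨lp (fun _ : I => ℝ) ∞, inferInstance, inferInstance, inferInstance,
    nonnegOnCone {f : I | Monotone f.1}, Set.range (RadonP.evalMap hI),
    hiso.isClosedEmbedding.isClosed_range, ?_, hiso.isometryEquivOnRange, fun a b => ?_, fun p =>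
      ⟨p.integrable_of_lipschitzWith hlip, hint p⟩⟩
  · rintro _ ⟨x, rfl⟩ _ ⟨y, rfl⟩ s t hs ht hst
    lift s to ℝ≥0 using hs
    lift t to ℝ≥0 using ht
    have hst' : s + t = 1 := NNReal.coe_injective (by simpa using hst)
    refine ⟨alg.comb s t hst' x y, ?_⟩
    rw [OrderedKantorovichAlgebra.comb, hint, RadonP.integral_mix hst' _ _ hlip,
      RadonP.integral_dirac_eq, RadonP.integral_dirac_eq]
  · change a ≤ b ↔ ∀ f ∈ {f : I | Monotone f.1}, 0 ≤ f.1 b - f.1 a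
    refine ⟨fun hab f hf => sub_nonneg.2 (hf hab), fun h => ?_⟩
    by_contra hab
    obtain ⟨f, hf, h0, haff, hm, hlt⟩ := alg.exists_isAffine_monotone_lt x₀ hab
    have := h ⟨f, hf, h0, haff⟩ hm
    simp only at this
    linarith
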